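/- Let $p>1$ be a real number and $n>1$ an integer. Put $F_{p,n}(y)=\int_0^y (1-t^n)^{-1/p}\,dt$ and $\pi_{p,n}=2F_{p,n}(1)$. Let $I_n=[-1,1]$ if $n$ is even and $I_n=(-\infty,1]$ if $n$ is odd. The function $F_{p,n}$ is strictly increasing on $I_n$; let $\sin_{p,n}:F_{p,n}(I_n)\to I_n$ be its inverse, whose domain is an interval with right endpoint $\tfrac12\pi_{p,n}$. Let $p'=p/(p-1)$ and $\mu(m,n)=\int_1^\infty (t^n-1)^{-(m-1)/m}\,dt\in(0,\infty]$. Then $\sin_{p,n}$ has an analytic extension at $\tfrac12\pi_{p,n}$ (a function that is real-analytic on an open interval around $\tfrac12\pi_{p,n}$ and that agrees with $\sin_{p,n}$ on the part of this interval lying in the domain of $\sin_{p,n}$) if and only if $p'$ is an integer. In that case, $\tfrac12\pi_{p,n}$ is a critical point of order $p'-1$ of the extension, i.e. the derivative of the extension has a zero of order exactly $p'-1\ge 1$ there, and the Taylor series of the extension at $\tfrac12\pi_{p,n}$ has radius of convergence exactly $\mu(p',n)$ (both are infinite when $p=n=2$). -/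

import Mathlib

open MeasureTheory Set Filter Topology
open scoped Nat ENNReal

noncomputable section

namespace GenSine

/-- `F_{p,n}(y) = ∫₀^y (1 - t^n)^(-1/p) dt`. -/
def F (p : ℝ) (n : ℕ) (y : ℝ) : ℝ :=
  ∫ t in (0 : ℝ)..y, 1 / (1 - t ^ n) ^ (1 / p)

/-- `π_{p,n} = 2 F_{p,n}(1)`. -/
def genPi (p : ℝ) (n : ℕ) : ℝ := 2 * F p n 1

/-- The real set on which `F_{p,n}` is considered, which is also the set of values of the
generalized sine: `[-1, 1]` for `n` even and `(-∞, 1]` for `n` odd. -/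
def sinValues (n : ℕ) : Set ℝ := if Even n then Icc (-1) 1 else Iic 1

/-- The domain of the generalized sine: the image of the above set under `F_{p,n}`, that is,
`[-π_{p,n}/2, π_{p,n}/2]` for `n` even and `(F_{p,n}(-∞), π_{p,n}/2]` for `n` odd. -/
def sinDomain (p : ℝ) (n : ℕ) : Set ℝ := F p n '' sinValues n

/-- The generalized sine `sin_{p,n}`, the inverse function of `F_{p,n}`. It is meaningful on
`sinDomain p n` only. -/
def genSin (p : ℝ) (n : ℕ) : ℝ → ℝ := Function.invFunOn (F p n) (sinValues n)

/-- The conjugate exponent `p' = p / (p - 1)`. -/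
def conj (p : ℝ) : ℝ := p / (p - 1)

/-- `μ(m,n) = ∫₁^∞ (t^n - 1)^(-(m-1)/m) dt`, as an element of `[0, ∞]`. -/
def mu (m : ℝ) (n : ℕ) : ℝ≥0∞ :=
  ∫⁻ t in Ioi (1 : ℝ), ENNReal.ofReal (1 / (t ^ n - 1) ^ ((m - 1) / m))

/-- `g` is an analytic extension at the point `a` of the function `f` with domain `s`: it is
real-analytic on a neighbourhood of `a` and agrees with `f` at the points of `s` near `a`. -/
def IsAnalyticExtensionAt (f : ℝ → ℝ) (s : Set ℝ) (a : ℝ) (g : ℝ → ℝ) : Prop :=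
  AnalyticAt ℝ g a ∧ g =ᶠ[𝓝[s] a] f

/-- `a` is a critical point of `g` of order `k`: the derivative of `g` has a zero of order
exactly `k ≥ 1` at `a`. -/
def IsCriticalPointOfOrder (g : ℝ → ℝ) (a : ℝ) (k : ℕ) : Prop :=
  1 ≤ k ∧ analyticOrderAt (deriv g) a = (k : ℕ∞)

/-- The Taylor series `∑ g⁽ᵏ⁾(a)/k! (x - a)^k` of `g` at `a`. -/
def taylorSeriesAt (g : ℝ → ℝ) (a : ℝ) : FormalMultilinearSeries ℝ ℝ ℝ :=
  FormalMultilinearSeries.ofScalars ℝ (fun k : ℕ => iteratedDeriv k g a / (k ! : ℝ))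

end GenSine

end

/-!
Near `a = π_{p,n} / 2`, with `z = a - x` and `m = p'`, the equation `s' = (1 - s ^ n) ^ (1 / p)` of
the generalized sine involves a fractional power. For integral `m`, the auxiliary function
`u = (1 - s ^ n) ^ (1 / m)` removes it: as functions of `z`, `S = s` and `U = u` solve the
polynomial system

  `S' = ε U ^ (m - 1)`, `U' = (n / m) S ^ (n - 1)`, `S(0) = 1`, `U(0) = 0`

with `ε = -1`, and `S ^ n - ε U ^ m = 1` is conserved. The system is first solved in formal power
series (`isFormalSolution_picard`). Let `(T, V)` be the solution for `ε = 1`. Its coefficients are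
nonnegative, and since `T(w z)`, `V(w z) / w` solves the system for `ε = -1` when `w ^ m = -1`, the
coefficients of `S` and `T` have the same absolute values (`IsFormalSolution.abs_coeff_eq`).
Hence `S` and `T` have the same radius of convergence.

The radius is `μ(m, n)`. On `[0, R)`, with `R` the radius, `T' = (T ^ n - 1) ^ ((m - 1) / m)`, so
that the part of the integral `μ(m, n)` over `(1, T(x))` equals `x`; this gives `R ≤ μ(m, n)`
(`IsFormalSolution.setLIntegral_eq`). If `R < μ(m, n)`, then `T` and `V` are bounded on `[0, R)`.
As the coefficients are nonnegative, a bound `B` for all partial sums at `R` propagates to a bound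
`2 B` at `R + δ`, by induction on the number of terms and the mean value inequality
(`IsFormalSolution.exists_convAt_add`), which contradicts the choice of `R`.

The function `x ↦ S(a - x)` is an analytic extension because `F(S(z)) + z` has derivative zero
(`exists_analytic_extension`). Conversely, an arbitrary analytic extension `g` satisfies
`g' = (1 - g ^ n) ^ (1 / p)` on the left of `a`. If `1 - g` vanishes at `a` to order `k`, comparing
both sides gives `k - 1 = k / p`, that is, `p' = k`, and `g'` vanishes to order `k - 1`
(`IsAnalyticExtensionAt.exists_order`).
-/

noncomputable section

namespace GenSine

open PowerSeries

/-! ### The formal initial value problem -/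

/-- The pair `(S, U)` of formal power series is the solution of the initial value problem
`S' = ε U ^ (m - 1)`, `U' = c S ^ (n - 1)`, `S(0) = 1`, `U(0) = 0`. -/
structure IsFormalSolution {K : Type*} [Field K] (m n : ℕ) (ε c : K) (S U : K⟦X⟧) : Prop where
  coeff_zero_fst : coeff 0 S = 1
  coeff_zero_snd : coeff 0 U = 0
  deriv_fst : d⁄dX K S = ε • U ^ (m - 1)
  deriv_snd : d⁄dX K U = c • S ^ (n - 1)

section Formal

variable {K : Type*} [Field K] {m n : ℕ} {ε c : K} {S U S' U' : K⟦X⟧}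

theorem coeff_pow_congr {k : ℕ} {f g : K⟦X⟧} (h : ∀ i ≤ k, coeff i f = coeff i g) (j : ℕ) :
    coeff k (f ^ j) = coeff k (g ^ j) := by
  have h1 : (X : K⟦X⟧) ^ (k + 1) ∣ f - g := by
    rw [X_pow_dvd_iff]
    intro i hi
    simp [h i (by omega)]
  have h2 := X_pow_dvd_iff.1 (h1.trans (sub_dvd_pow_sub_pow f g j)) k (by omega)
  simpa [sub_eq_zero] using h2

theorem coeff_succ_of_derivative [CharZero K] {f g : K⟦X⟧} (h : d⁄dX K f = g) (k : ℕ) :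
    coeff (k + 1) f = coeff k g / (k + 1) := by
  have : (k + 1 : K) ≠ 0 := by exact_mod_cast Nat.succ_ne_zero k
  rw [← h, coeff_derivative]
  field_simp

theorem derivative_eq_of_coeff_succ [CharZero K] {f g : K⟦X⟧}
    (h : ∀ k, coeff (k + 1) f = coeff k g / (k + 1)) : d⁄dX K f = g := by
  ext k
  have : (k + 1 : K) ≠ 0 := by exact_mod_cast Nat.succ_ne_zero k
  rw [coeff_derivative, h]
  field_simp

/-- The Picard iterates of the initial value problem of `IsFormalSolution`. -/
def picard (m n : ℕ) (ε c : K) : ℕ → K⟦X⟧ × K⟦X⟧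
  | 0 => (1, 0)
  | N + 1 =>
    (mk fun k => k.casesOn 1 fun k => ε * coeff k ((picard m n ε c N).2 ^ (m - 1)) / (k + 1),
     mk fun k => k.casesOn 0 fun k => c * coeff k ((picard m n ε c N).1 ^ (n - 1)) / (k + 1))

theorem coeff_picard_eq (m n : ℕ) (ε c : K) {k N M : ℕ} (hN : k ≤ N) (hM : k ≤ M) :
    coeff k (picard m n ε c N).1 = coeff k (picard m n ε c M).1 ∧
      coeff k (picard m n ε c N).2 = coeff k (picard m n ε c M).2 := by
  induction k using Nat.strong_induction_on generalizing N M with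
  | _ k ih =>
    rcases k with _ | k
    · rcases N with _ | N <;> rcases M with _ | M <;> simp [picard]
    · obtain ⟨N, rfl⟩ : ∃ N', N = N' + 1 := ⟨N - 1, by omega⟩
      obtain ⟨M, rfl⟩ : ∃ M', M = M' + 1 := ⟨M - 1, by omega⟩
      have h : ∀ i ≤ k, _ := fun i (hi : i ≤ k) =>
        ih i (by omega) (N := N) (M := M) (by omega) (by omega)
      simp only [picard, coeff_mk]
      rw [coeff_pow_congr (fun i hi => (h i hi).1), coeff_pow_congr (fun i hi => (h i hi).2)]
      exact ⟨rfl, rfl⟩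

/-- The coefficient of `X ^ k` is the same in all Picard iterates from the `k`-th on; these
stable values are the coefficients of the solution. -/
theorem isFormalSolution_picard [CharZero K] (m n : ℕ) (ε c : K) :
    IsFormalSolution m n ε c (mk fun k => coeff k (picard m n ε c k).1)
      (mk fun k => coeff k (picard m n ε c k).2) := by
  refine ⟨by simp [picard], by simp [picard], ?_, ?_⟩
  · refine derivative_eq_of_coeff_succ fun k => ?_
    rw [coeff_mk, picard, coeff_mk, coeff_smul, smul_eq_mul]
    dsimp only
    rw [coeff_pow_congr fun i hi => ?_]
    rw [coeff_mk]
    exact (coeff_picard_eq m n ε c hi le_rfl).2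
  · refine derivative_eq_of_coeff_succ fun k => ?_
    rw [coeff_mk, picard, coeff_mk, coeff_smul, smul_eq_mul]
    dsimp only
    rw [coeff_pow_congr fun i hi => ?_]
    rw [coeff_mk]
    exact (coeff_picard_eq m n ε c hi le_rfl).1

namespace IsFormalSolution

theorem coeff_succ_fst [CharZero K] (h : IsFormalSolution m n ε c S U) (k : ℕ) :
    coeff (k + 1) S = ε * coeff k (U ^ (m - 1)) / (k + 1) := by
  rw [coeff_succ_of_derivative h.deriv_fst, coeff_smul, smul_eq_mul]

theorem coeff_succ_snd [CharZero K] (h : IsFormalSolution m n ε c S U) (k : ℕ) :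
    coeff (k + 1) U = c * coeff k (S ^ (n - 1)) / (k + 1) := by
  rw [coeff_succ_of_derivative h.deriv_snd, coeff_smul, smul_eq_mul]

protected theorem unique [CharZero K] (h : IsFormalSolution m n ε c S U)
    (h' : IsFormalSolution m n ε c S' U') : S = S' ∧ U = U' := by
  have key : ∀ k, coeff k S = coeff k S' ∧ coeff k U = coeff k U' := by
    intro k
    induction k using Nat.strong_induction_on with
    | _ k ih =>
      rcases k with _ | k
      · rw [h.coeff_zero_fst, h'.coeff_zero_fst, h.coeff_zero_snd, h'.coeff_zero_snd]
        exact ⟨rfl, rfl⟩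
      · rw [h.coeff_succ_fst, h'.coeff_succ_fst, h.coeff_succ_snd, h'.coeff_succ_snd,
          coeff_pow_congr (fun i hi => (ih i (by omega)).1),
          coeff_pow_congr (fun i hi => (ih i (by omega)).2)]
        exact ⟨rfl, rfl⟩
  exact ⟨PowerSeries.ext fun k => (key k).1, PowerSeries.ext fun k => (key k).2⟩

/-- The conserved quantity of the system, which replaces the equation
`S' = ± |S ^ n - 1| ^ ((m - 1) / m)` by a polynomial relation. -/
theorem pow_eq [CharZero K] (h : IsFormalSolution m n ε (n / m) S U) (hm : m ≠ 0) (hn : n ≠ 0) :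
    S ^ n = 1 + ε • U ^ m := by
  have hm' : (m : K) ≠ 0 := by exact_mod_cast hm
  refine derivative.ext ?_ ?_
  · rw [derivative_pow, map_add, derivative_one, Derivation.map_smul, derivative_pow, h.deriv_fst,
      h.deriv_snd, zero_add]
    simp only [smul_eq_C_mul]
    rw [show (n : K⟦X⟧) = C (n : K) by simp, show (m : K⟦X⟧) = C (m : K) by simp]
    have : C (n : K) = C (m : K) * C ((n : K) / m) := by
      rw [← map_mul]; congr 1; field_simp
    rw [this]
    ring
  · have h0 : constantCoeff S = 1 := by simpa using h.coeff_zero_fst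
    have h1 : constantCoeff U = 0 := by simpa using h.coeff_zero_snd
    simp [smul_eq_C_mul, h0, h1, hm]

theorem map {L : Type*} [Field L] (f : K →+* L) (h : IsFormalSolution m n ε c S U) :
    IsFormalSolution m n (f ε) (f c) (PowerSeries.map f S) (PowerSeries.map f U) := by
  have hd (g : K⟦X⟧) : d⁄dX L (PowerSeries.map f g) = PowerSeries.map f (d⁄dX K g) := by
    ext k; simp [coeff_derivative]
  refine ⟨?_, ?_, ?_, ?_⟩
  · rw [coeff_map, h.coeff_zero_fst, map_one]
  · rw [coeff_map, h.coeff_zero_snd, map_zero]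
  · rw [hd, h.deriv_fst, smul_eq_C_mul, smul_eq_C_mul, map_mul, map_pow, map_C]
  · rw [hd, h.deriv_snd, smul_eq_C_mul, smul_eq_C_mul, map_mul, map_pow, map_C]

/-- Scaling the variable by an `m`-th root `w` of `-1` turns the solution for the sign `1` into
the solution for the sign `-1`. -/
theorem rescale {w : K} (hm : m ≠ 0) (hw : w ^ m = -1) (h : IsFormalSolution m n 1 c S U) :
    IsFormalSolution m n (-1) c (PowerSeries.rescale w S) (w⁻¹ • PowerSeries.rescale w U) := by
  have hw0 : w ≠ 0 := by rintro rfl; simp [hm] at hw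
  have hd (g : K⟦X⟧) :
      d⁄dX K (PowerSeries.rescale w g) = w • PowerSeries.rescale w (d⁄dX K g) := by
    ext k; simp [coeff_derivative, coeff_rescale, pow_succ]; ring
  have hs (a : K) (g : K⟦X⟧) :
      PowerSeries.rescale w (a • g) = a • PowerSeries.rescale w g := by
    ext k; simp [coeff_rescale]; ring
  refine ⟨?_, ?_, ?_, ?_⟩
  · rw [coeff_rescale, h.coeff_zero_fst]; simp
  · rw [coeff_smul, coeff_rescale, h.coeff_zero_snd]; simp
  · rw [hd, h.deriv_fst, one_smul, map_pow, smul_pow, smul_smul]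
    congr 1
    have : w ^ m = w ^ (m - 1) * w := by rw [← pow_succ, Nat.sub_add_cancel (by omega)]
    rw [← hw, this, inv_pow]
    field_simp
  · rw [Derivation.map_smul, hd, smul_smul, inv_mul_cancel₀ hw0, one_smul, h.deriv_snd,
      hs, map_pow]

end IsFormalSolution

end Formal

/-- The coefficients of the solutions for the two signs agree up to sign. -/
theorem IsFormalSolution.abs_coeff_eq {m n : ℕ} {c : ℝ} {S U T V : ℝ⟦X⟧} (hm : m ≠ 0)
    (hS : IsFormalSolution m n (-1) c S U) (hT : IsFormalSolution m n 1 c T V) (k : ℕ) :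
    |coeff k S| = |coeff k T| ∧ |coeff k U| = |coeff k V| := by
  obtain ⟨w, hw⟩ := IsAlgClosed.exists_pow_nat_eq (-1 : ℂ) (Nat.pos_of_ne_zero hm)
  have hw1 : ‖w‖ = 1 := by
    have : ‖w‖ ^ m = 1 := by rw [← norm_pow, hw]; simp
    exact (pow_eq_one_iff_of_nonneg (norm_nonneg _) hm).1 this
  have hT' := hT.map Complex.ofRealHom
  rw [map_one] at hT'
  have hS' := hS.map Complex.ofRealHom
  rw [map_neg, map_one] at hS'
  obtain ⟨h1, h2⟩ := hS'.unique (hT'.rescale hm hw)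
  constructor
  · have := congrArg (fun f => ‖coeff k f‖) h1
    simpa [coeff_rescale, hw1] using this
  · have := congrArg (fun f => ‖coeff k f‖) h2
    simpa [coeff_rescale, hw1] using this

theorem coeff_mul_nonneg {f g : ℝ⟦X⟧} (hf : ∀ k, 0 ≤ coeff k f) (hg : ∀ k, 0 ≤ coeff k g)
    (k : ℕ) : 0 ≤ coeff k (f * g) := by
  rw [coeff_mul]
  exact Finset.sum_nonneg fun i _ => mul_nonneg (hf _) (hg _)

theorem coeff_pow_nonneg {f : ℝ⟦X⟧} (hf : ∀ k, 0 ≤ coeff k f) (j k : ℕ) :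
    0 ≤ coeff k (f ^ j) := by
  induction j generalizing k with
  | zero => rw [pow_zero, coeff_one]; split_ifs <;> simp
  | succ j ih => rw [pow_succ]; exact coeff_mul_nonneg ih hf k

theorem IsFormalSolution.coeff_nonneg {m n : ℕ} {c : ℝ} {T V : ℝ⟦X⟧} (hc : 0 ≤ c)
    (h : IsFormalSolution m n 1 c T V) (k : ℕ) : 0 ≤ coeff k T ∧ 0 ≤ coeff k V := by
  have key : ∀ N k, 0 ≤ coeff k (picard m n 1 c N).1 ∧ 0 ≤ coeff k (picard m n 1 c N).2 := by
    intro N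
    induction N with
    | zero => intro k; simp only [picard, coeff_one, map_zero, le_refl, and_true]; split_ifs <;> simp
    | succ N ih =>
      rintro (_ | k)
      · simp [picard]
      · simp only [picard, coeff_mk, one_mul]
        have h1 := coeff_pow_nonneg (fun k => (ih k).1) (n - 1) k
        have h2 := coeff_pow_nonneg (fun k => (ih k).2) (m - 1) k
        constructor <;> positivity
  obtain ⟨rfl, rfl⟩ := h.unique (isFormalSolution_picard m n 1 c)
  simpa using key k k

/-! ### Sums of absolutely convergent power series -/

/-- Absolute convergence of the real power series `f` at the point `x`. -/
def ConvAt (f : ℝ⟦X⟧) (x : ℝ) : Prop := Summable fun k => ‖coeff k f * x ^ k‖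

/-- The sum of the real power series `f` at the point `x` (zero without absolute convergence). -/
def sumAt (f : ℝ⟦X⟧) (x : ℝ) : ℝ := ∑' k, coeff k f * x ^ k

/-- The sum of the first `N` terms of the power series `f` at `x`. -/
def partialSum (f : ℝ⟦X⟧) (N : ℕ) (x : ℝ) : ℝ := ∑ k ∈ Finset.range N, coeff k f * x ^ k

theorem ConvAt.mono {f : ℝ⟦X⟧} {x y : ℝ} (h : ConvAt f y) (hxy : |x| ≤ |y|) : ConvAt f x := by
  refine Summable.of_nonneg_of_le (fun k => norm_nonneg _) (fun k => ?_) h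
  simp only [norm_mul, norm_pow, Real.norm_eq_abs]
  gcongr

theorem convAt_of_abs_coeff_le {f g : ℝ⟦X⟧} {x : ℝ} (h : ConvAt g x)
    (hfg : ∀ k, |coeff k f| ≤ |coeff k g|) : ConvAt f x := by
  refine Summable.of_nonneg_of_le (fun k => norm_nonneg _) (fun k => ?_) h
  simp only [norm_mul, norm_pow, Real.norm_eq_abs]
  exact mul_le_mul_of_nonneg_right (hfg k) (by positivity)

theorem coeff_mul_mul_pow (f g : ℝ⟦X⟧) (x : ℝ) (k : ℕ) :
    coeff k (f * g) * x ^ k =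
      ∑ i ∈ Finset.HasAntidiagonal.antidiagonal k, (coeff i.1 f * x ^ i.1) * (coeff i.2 g * x ^ i.2) := by
  rw [coeff_mul, Finset.sum_mul]
  refine Finset.sum_congr rfl fun i hi => ?_
  rw [← Finset.HasAntidiagonal.mem_antidiagonal.1 hi, pow_add]
  ring

theorem ConvAt.mul {f g : ℝ⟦X⟧} {x : ℝ} (hf : ConvAt f x) (hg : ConvAt g x) :
    ConvAt (f * g) x := by
  unfold ConvAt at hf hg ⊢
  simp only [coeff_mul_mul_pow]
  exact summable_norm_sum_mul_antidiagonal_of_summable_norm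
    (f := fun k => coeff k f * x ^ k) (g := fun k => coeff k g * x ^ k) hf hg

theorem sumAt_mul {f g : ℝ⟦X⟧} {x : ℝ} (hf : ConvAt f x) (hg : ConvAt g x) :
    sumAt (f * g) x = sumAt f x * sumAt g x := by
  simp only [sumAt, coeff_mul_mul_pow]
  exact (tsum_mul_tsum_eq_tsum_sum_antidiagonal_of_summable_norm hf hg).symm

theorem hasSum_one (x : ℝ) : HasSum (fun k => coeff k (1 : ℝ⟦X⟧) * x ^ k) 1 := by
  have := hasSum_single (f := fun k => coeff k (1 : ℝ⟦X⟧) * x ^ k) 0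
    (fun k hk => by simp [coeff_one, hk])
  simpa using this

theorem convAt_one (x : ℝ) : ConvAt 1 x := (hasSum_one x).summable.norm

theorem sumAt_one (x : ℝ) : sumAt 1 x = 1 := (hasSum_one x).tsum_eq

theorem ConvAt.pow {f : ℝ⟦X⟧} {x : ℝ} (hf : ConvAt f x) (j : ℕ) : ConvAt (f ^ j) x := by
  induction j with
  | zero => rw [pow_zero]; exact convAt_one x
  | succ j ih => rw [pow_succ]; exact ih.mul hf

theorem sumAt_pow {f : ℝ⟦X⟧} {x : ℝ} (hf : ConvAt f x) (j : ℕ) :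
    sumAt (f ^ j) x = sumAt f x ^ j := by
  induction j with
  | zero => rw [pow_zero, pow_zero, sumAt_one]
  | succ j ih => rw [pow_succ, sumAt_mul (hf.pow j) hf, ih, pow_succ]

theorem sumAt_smul (a : ℝ) (f : ℝ⟦X⟧) (x : ℝ) : sumAt (a • f) x = a * sumAt f x := by
  simp only [sumAt, coeff_smul, smul_eq_mul, mul_assoc, tsum_mul_left]

theorem ConvAt.smul {f : ℝ⟦X⟧} {x : ℝ} (hf : ConvAt f x) (a : ℝ) : ConvAt (a • f) x := by
  simp only [ConvAt, coeff_smul, smul_eq_mul, mul_assoc, norm_mul a]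
  exact hf.mul_left _

theorem sumAt_add {f g : ℝ⟦X⟧} {x : ℝ} (hf : ConvAt f x) (hg : ConvAt g x) :
    sumAt (f + g) x = sumAt f x + sumAt g x := by
  simp only [sumAt, map_add, add_mul]
  exact hf.of_norm.tsum_add hg.of_norm

theorem convAt_zero (f : ℝ⟦X⟧) : ConvAt f 0 :=
  summable_of_ne_finset_zero (s := {0}) fun k hk => by
    simp [Finset.mem_singleton.not.1 hk]

theorem sumAt_zero (f : ℝ⟦X⟧) : sumAt f 0 = coeff 0 f := by
  rw [sumAt, tsum_eq_single 0 fun k hk => by simp [hk]]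
  simp

theorem add_pow_succ_bounds {x h : ℝ} (hx : 0 ≤ x) (hh : 0 ≤ h) (k : ℕ) :
    x ^ (k + 1) + (k + 1) * h * x ^ k ≤ (x + h) ^ (k + 1) ∧
      (x + h) ^ (k + 1) ≤ x ^ (k + 1) + (k + 1) * h * (x + h) ^ k := by
  induction k with
  | zero => simp
  | succ k ih =>
    obtain ⟨h1, h2⟩ := ih
    have h3 : x ^ (k + 1) ≤ (x + h) ^ (k + 1) := pow_le_pow_left₀ hx (by linarith) _
    have h4 : 0 ≤ x ^ k := by positivity
    push_cast
    constructor
    · rw [pow_succ (x + h) (k + 1)]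
      have := mul_le_mul_of_nonneg_right h1 (add_nonneg hx hh)
      refine le_trans ?_ this
      have h5 : 0 ≤ (k + 1) * h * x ^ k * h := by positivity
      rw [pow_succ x (k + 1), pow_succ x k]
      nlinarith
    · have := mul_le_mul_of_nonneg_right h2 (add_nonneg hx hh)
      rw [← pow_succ] at this
      refine this.trans ?_
      have h5 : h * x ^ (k + 1) ≤ h * (x + h) ^ (k + 1) := by gcongr
      rw [pow_succ (x + h) k] at *
      rw [pow_succ x (k + 1)]
      nlinarith

theorem hasDerivAt_sumAt {f : ℝ⟦X⟧} {x y : ℝ} (hf : ConvAt f y) (hxy : |x| < |y|) :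
    HasDerivAt (sumAt f) (sumAt (d⁄dX ℝ f) x) x := by
  obtain ⟨ρ, hxρ, hρy⟩ := exists_between hxy
  have hρ : 0 ≤ ρ := (abs_nonneg x).trans hxρ.le
  have hb : Summable fun k : ℕ => |coeff k f| * (k * ρ ^ (k - 1)) := by
    have hd : 0 < |y| - ρ := sub_pos.2 hρy
    refine Summable.of_nonneg_of_le (fun k => by positivity) (fun k => ?_)
      (hf.mul_left (|y| - ρ)⁻¹)
    rw [norm_mul, norm_pow, Real.norm_eq_abs, Real.norm_eq_abs,
      mul_left_comm (|y| - ρ)⁻¹]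
    refine mul_le_mul_of_nonneg_left ?_ (abs_nonneg _)
    rw [le_inv_mul_iff₀ hd]
    rcases k with _ | k
    · simp
    · have := (add_pow_succ_bounds hρ hd.le k).1
      rw [add_sub_cancel] at this
      have h2 : 0 ≤ ρ ^ (k + 1) := by positivity
      push_cast
      linarith
  have hx : x ∈ Ioo (-ρ) ρ := abs_lt.1 hxρ
  have key := hasDerivAt_tsum_of_isPreconnected (𝕜 := ℝ) (t := Ioo (-ρ) ρ)
    (g := fun k z => coeff k f * z ^ k) (g' := fun k z => coeff k f * (k * z ^ (k - 1)))
    hb isOpen_Ioo isPreconnected_Ioo (fun k z _ => (hasDerivAt_pow k z).const_mul _)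
    (fun k z hz => by
      rw [norm_mul, norm_mul, norm_pow, Real.norm_eq_abs, Real.norm_eq_abs, Real.norm_eq_abs,
        Nat.abs_cast]
      have : |z| ≤ ρ := (abs_lt.2 hz).le
      gcongr) hx (hf.mono hxy.le).of_norm hx
  have hs : Summable fun k : ℕ => coeff k f * (k * x ^ (k - 1)) := by
    refine Summable.of_norm_bounded hb fun k => ?_
    rw [norm_mul, norm_mul, norm_pow, Real.norm_eq_abs, Real.norm_eq_abs, Real.norm_eq_abs,
        Nat.abs_cast]
    gcongr
  have : sumAt (d⁄dX ℝ f) x = ∑' k : ℕ, coeff k f * (k * x ^ (k - 1)) := by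
    rw [hs.tsum_eq_zero_add, sumAt]
    simp [coeff_derivative, mul_assoc]
  rw [this]
  exact key

/-! ### Partial sums of series with nonnegative coefficients -/

theorem partialSum_nonneg {f : ℝ⟦X⟧} (hf : ∀ k, 0 ≤ coeff k f) {x : ℝ} (hx : 0 ≤ x) (N : ℕ) :
    0 ≤ partialSum f N x :=
  Finset.sum_nonneg fun k _ => mul_nonneg (hf k) (pow_nonneg hx k)

theorem partialSum_mul_le {f g : ℝ⟦X⟧} (hf : ∀ k, 0 ≤ coeff k f) (hg : ∀ k, 0 ≤ coeff k g)
    {x : ℝ} (hx : 0 ≤ x) (N : ℕ) :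
    partialSum (f * g) N x ≤ partialSum f N x * partialSum g N x := by
  simp only [partialSum, coeff_mul_mul_pow]
  rw [Finset.sum_mul_sum, ← Finset.sum_product', ← Finset.sum_biUnion]
  · refine Finset.sum_le_sum_of_subset_of_nonneg (fun i hi => ?_) fun i _ _ => ?_
    · simp only [Finset.mem_biUnion, Finset.mem_range, Finset.HasAntidiagonal.mem_antidiagonal] at hi
      obtain ⟨k, hk, hik⟩ := hi
      simp only [Finset.mem_product, Finset.mem_range]
      omega
    · have := hf i.1
      have := hg i.2
      positivity
  · intro k _ l _ hkl
    rw [Function.onFun, Finset.disjoint_left]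
    intro i hi hi'
    rw [Finset.HasAntidiagonal.mem_antidiagonal] at hi hi'
    exact hkl (hi.symm.trans hi')

theorem partialSum_pow_le {f : ℝ⟦X⟧} (hf : ∀ k, 0 ≤ coeff k f) {x : ℝ} (hx : 0 ≤ x)
    (j N : ℕ) : partialSum (f ^ j) N x ≤ partialSum f N x ^ j := by
  induction j with
  | zero =>
    rw [pow_zero, pow_zero]
    refine sum_le_hasSum _ (fun k _ => ?_) (hasSum_one x)
    rw [coeff_one]
    split_ifs <;> positivity
  | succ j ih =>
    rw [pow_succ, pow_succ]
    exact (partialSum_mul_le (coeff_pow_nonneg hf j) hf hx N).trans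
      (mul_le_mul_of_nonneg_right ih (partialSum_nonneg hf hx N))

theorem partialSum_smul (a : ℝ) (f : ℝ⟦X⟧) (N : ℕ) (x : ℝ) :
    partialSum (a • f) N x = a * partialSum f N x := by
  simp only [partialSum, coeff_smul, smul_eq_mul, mul_assoc, Finset.mul_sum]

theorem continuous_partialSum (f : ℝ⟦X⟧) (N : ℕ) : Continuous (partialSum f N) := by
  unfold partialSum
  fun_prop

/-- The mean value inequality for the partial sums of a series with nonnegative coefficients. -/
theorem partialSum_add_le {f : ℝ⟦X⟧} (hf : ∀ k, 0 ≤ coeff k f) {x h : ℝ} (hx : 0 ≤ x)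
    (hh : 0 ≤ h) (N : ℕ) :
    partialSum f (N + 1) (x + h) ≤
      partialSum f (N + 1) x + h * partialSum (d⁄dX ℝ f) N (x + h) := by
  simp only [partialSum]
  rw [Finset.sum_range_succ', Finset.sum_range_succ', Finset.mul_sum, add_right_comm,
    ← Finset.sum_add_distrib]
  simp only [pow_zero]
  gcongr with k
  rw [coeff_derivative]
  have := mul_le_mul_of_nonneg_left (add_pow_succ_bounds hx hh k).2 (hf (k + 1))
  linarith

theorem partialSum_le_sumAt {f : ℝ⟦X⟧} (hf : ∀ k, 0 ≤ coeff k f) {x : ℝ} (hx : 0 ≤ x)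
    (h : ConvAt f x) (N : ℕ) : partialSum f N x ≤ sumAt f x :=
  h.of_norm.sum_le_tsum _ fun k _ => mul_nonneg (hf k) (pow_nonneg hx k)

theorem convAt_of_partialSum_le {f : ℝ⟦X⟧} (hf : ∀ k, 0 ≤ coeff k f) {x B : ℝ} (hx : 0 ≤ x)
    (h : ∀ N, partialSum f N x ≤ B) : ConvAt f x :=
  (summable_of_sum_range_le (fun k => mul_nonneg (hf k) (pow_nonneg hx k)) h).norm

/-! ### The set of convergence of the solution with nonnegative coefficients -/

namespace IsFormalSolution

variable {m n : ℕ} {c : ℝ} {T V : ℝ⟦X⟧}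

theorem convAt_snd (hc : 0 ≤ c) (h : IsFormalSolution m n 1 c T V) {x : ℝ} (hx : 0 ≤ x)
    (hT : ConvAt T x) : ConvAt V x := by
  have hT0 := fun k => (h.coeff_nonneg hc k).1
  have hV0 := fun k => (h.coeff_nonneg hc k).2
  have key (N : ℕ) : partialSum V (N + 1) x ≤ x * (c * sumAt T x ^ (n - 1)) := by
    have h1 := partialSum_add_le hV0 le_rfl hx N
    have h2 : partialSum V (N + 1) 0 = 0 := by
      simp [partialSum, Finset.sum_range_succ', h.coeff_zero_snd]
    rw [h2, zero_add, zero_add, h.deriv_snd, partialSum_smul] at h1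
    refine h1.trans ?_
    gcongr
    refine (partialSum_pow_le hT0 hx _ _).trans ?_
    exact pow_le_pow_left₀ (partialSum_nonneg hT0 hx N) (partialSum_le_sumAt hT0 hx hT N) _
  refine convAt_of_partialSum_le hV0 hx fun N => le_trans ?_ (key N)
  exact Finset.sum_le_sum_of_subset_of_nonneg (Finset.range_mono (Nat.le_succ N))
    fun k _ _ => mul_nonneg (hV0 k) (pow_nonneg hx k)

/-- A uniform bound for the partial sums of the solution at `x` propagates to a point to the
right of `x`; in particular the series converges beyond `x`. -/
theorem exists_convAt_add (hc : 0 ≤ c) (h : IsFormalSolution m n 1 c T V) {x B : ℝ} (hx : 0 ≤ x)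
    (hT : ∀ N, partialSum T N x ≤ B) (hV : ∀ N, partialSum V N x ≤ B) :
    ∃ δ > 0, ConvAt T (x + δ) := by
  have hT0 := fun k => (h.coeff_nonneg hc k).1
  have hV0 := fun k => (h.coeff_nonneg hc k).2
  have hB : 1 ≤ B := by
    refine le_trans ?_ (hT 1)
    simp [partialSum, h.coeff_zero_fst]
  -- `M` bounds both right-hand sides of the system for values up to `2 B`, so that a step of
  -- length `B / M` adds at most `B`.
  set M := (2 * B) ^ (m - 1) + c * (2 * B) ^ (n - 1) with hM
  have hM0 : 0 < M := by positivity
  have hxδ : 0 ≤ x + B / M := by positivity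
  have hδ : 0 ≤ B / M := by positivity
  have key (N : ℕ) : partialSum T N (x + B / M) ≤ 2 * B ∧ partialSum V N (x + B / M) ≤ 2 * B := by
    induction N with
    | zero => simp only [partialSum, Finset.range_zero, Finset.sum_empty]; constructor <;> linarith
    | succ N ih =>
      have h1 := partialSum_add_le hT0 hx hδ N
      have h2 := partialSum_add_le hV0 hx hδ N
      rw [h.deriv_fst, partialSum_smul, one_mul] at h1
      rw [h.deriv_snd, partialSum_smul] at h2
      have h3 : partialSum (V ^ (m - 1)) N (x + B / M) ≤ (2 * B) ^ (m - 1) :=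
        (partialSum_pow_le hV0 hxδ _ _).trans
          (pow_le_pow_left₀ (partialSum_nonneg hV0 hxδ N) ih.2 _)
      have h4 : partialSum (T ^ (n - 1)) N (x + B / M) ≤ (2 * B) ^ (n - 1) :=
        (partialSum_pow_le hT0 hxδ _ _).trans
          (pow_le_pow_left₀ (partialSum_nonneg hT0 hxδ N) ih.1 _)
      have h5 : B / M * M = B := by field_simp
      have h6 : B / M * partialSum (V ^ (m - 1)) N (x + B / M) ≤ B / M * M := by
        gcongr
        exact h3.trans (le_add_of_nonneg_right (by positivity))
      have h7 : B / M * (c * partialSum (T ^ (n - 1)) N (x + B / M)) ≤ B / M * M := by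
        gcongr
        exact (mul_le_mul_of_nonneg_left h4 hc).trans (le_add_of_nonneg_left (by positivity))
      have := hT (N + 1)
      have := hV (N + 1)
      constructor <;> linarith
  exact ⟨B / M, by positivity, convAt_of_partialSum_le hT0 hxδ fun N => (key N).1⟩

theorem exists_convAt_gt (hc : 0 ≤ c) (h : IsFormalSolution m n 1 c T V) {x : ℝ} (hx : 0 ≤ x)
    (hT : ConvAt T x) : ∃ y > x, ConvAt T y := by
  have hT0 := fun k => (h.coeff_nonneg hc k).1
  have hV0 := fun k => (h.coeff_nonneg hc k).2
  obtain ⟨δ, hδ, h'⟩ := h.exists_convAt_add hc hx (B := max (sumAt T x) (sumAt V x))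
    (fun N => (partialSum_le_sumAt hT0 hx hT N).trans (le_max_left _ _))
    (fun N => (partialSum_le_sumAt hV0 hx (h.convAt_snd hc hx hT) N).trans (le_max_right _ _))
  exact ⟨x + δ, by linarith, h'⟩

end IsFormalSolution

/-! ### The radius of convergence -/

theorem pow_rpow_sub_one_div {m : ℕ} (hm : m ≠ 0) {v : ℝ} (hv : 0 ≤ v) :
    (v ^ m) ^ (((m : ℝ) - 1) / m) = v ^ (m - 1) := by
  have hm' : (m : ℝ) ≠ 0 := by exact_mod_cast hm
  rw [← Real.rpow_natCast v m, ← Real.rpow_mul hv, mul_div_cancel₀ _ hm', ← Real.rpow_natCast,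
    Nat.cast_sub (Nat.one_le_iff_ne_zero.2 hm), Nat.cast_one]

namespace IsFormalSolution

variable {m n : ℕ} {ε c : ℝ} {S U T V : ℝ⟦X⟧} {x y : ℝ}

theorem hasDerivAt_fst (h : IsFormalSolution m n ε c S U) (hS : ConvAt S y) (hU : ConvAt U y)
    (hxy : |x| < |y|) : HasDerivAt (sumAt S) (ε * sumAt U x ^ (m - 1)) x := by
  have := hasDerivAt_sumAt hS hxy
  rwa [h.deriv_fst, sumAt_smul, sumAt_pow (hU.mono hxy.le)] at this

theorem hasDerivAt_snd (h : IsFormalSolution m n ε c S U) (hS : ConvAt S y) (hU : ConvAt U y)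
    (hxy : |x| < |y|) : HasDerivAt (sumAt U) (c * sumAt S x ^ (n - 1)) x := by
  have := hasDerivAt_sumAt hU hxy
  rwa [h.deriv_snd, sumAt_smul, sumAt_pow (hS.mono hxy.le)] at this

theorem sumAt_pow_eq (h : IsFormalSolution m n ε (n / m) S U) (hm : m ≠ 0) (hn : n ≠ 0)
    (hS : ConvAt S x) (hU : ConvAt U x) : sumAt S x ^ n = 1 + ε * sumAt U x ^ m := by
  rw [← sumAt_pow hS, h.pow_eq hm hn, sumAt_add (convAt_one x) ((hU.pow m).smul ε), sumAt_one,
    sumAt_smul, sumAt_pow hU]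

theorem sumAt_fst_zero (h : IsFormalSolution m n ε c S U) : sumAt S 0 = 1 := by
  rw [sumAt_zero, h.coeff_zero_fst]

theorem sumAt_snd_zero (h : IsFormalSolution m n ε c S U) : sumAt U 0 = 0 := by
  rw [sumAt_zero, h.coeff_zero_snd]

theorem one_le_sumAt_fst (hc : 0 ≤ c) (h : IsFormalSolution m n 1 c T V) (hx : 0 ≤ x)
    (hT : ConvAt T x) : 1 ≤ sumAt T x := by
  refine le_trans ?_ (partialSum_le_sumAt (fun k => (h.coeff_nonneg hc k).1) hx hT 1)
  simp [partialSum, h.coeff_zero_fst]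

theorem sumAt_snd_pos (hc : 0 < c) (h : IsFormalSolution m n 1 c T V) (hx : 0 < x)
    (hT : ConvAt T x) : 0 < sumAt V x := by
  refine lt_of_lt_of_le ?_ (partialSum_le_sumAt (fun k => (h.coeff_nonneg hc.le k).2) hx.le
    (h.convAt_snd hc.le hx.le hT) 2)
  have h1 : coeff 0 (T ^ (n - 1)) = 1 := by
    have h0 : constantCoeff T = 1 := by simpa using h.coeff_zero_fst
    simp [h0]
  simp only [partialSum, Finset.sum_range_succ, Finset.range_zero, Finset.sum_empty,
    h.coeff_zero_snd, h.coeff_succ_snd 0, h1]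
  norm_num
  positivity

theorem continuousOn_and_strictMonoOn_sumAt (hc : 0 < c)
    (h : IsFormalSolution m n 1 c T V) (hx : 0 ≤ x) (hT : ConvAt T x) :
    ContinuousOn (sumAt T) (Icc 0 x) ∧ StrictMonoOn (sumAt T) (Icc 0 x) := by
  obtain ⟨y, hxy, hy⟩ := h.exists_convAt_gt hc.le hx hT
  have hV := h.convAt_snd hc.le (hx.trans hxy.le) hy
  have hd : ∀ z ∈ Icc 0 x, HasDerivAt (sumAt T) (1 * sumAt V z ^ (m - 1)) z := fun z hz =>
    h.hasDerivAt_fst hy hV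
      (by rw [abs_of_nonneg hz.1, abs_of_nonneg (hx.trans hxy.le)]; exact hz.2.trans_lt hxy)
  have hcont : ContinuousOn (sumAt T) (Icc 0 x) := fun z hz =>
    (hd z hz).continuousAt.continuousWithinAt
  refine ⟨hcont, strictMonoOn_of_deriv_pos (convex_Icc 0 x) hcont fun z hz => ?_⟩
  rw [interior_Icc] at hz
  rw [(hd z (Ioo_subset_Icc_self hz)).deriv, one_mul]
  refine pow_pos (h.sumAt_snd_pos hc hz.1 (hT.mono ?_)) _
  rw [abs_of_nonneg hz.1.le, abs_of_nonneg hx]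
  exact hz.2.le

/-- The substitution `t = T(z)` in the integral that defines `mu`: along the solution, the
integrand is `1 / T'(z)`. -/
theorem setLIntegral_eq (hm : m ≠ 0) (hn : n ≠ 0) (h : IsFormalSolution m n 1 (n / m : ℝ) T V)
    (hx : 0 ≤ x) (hT : ConvAt T x) :
    ∫⁻ t in Ioo 1 (sumAt T x), ENNReal.ofReal (1 / (t ^ n - 1) ^ (((m : ℝ) - 1) / m)) =
      ENNReal.ofReal x := by
  have hc : (0 : ℝ) < n / m := by positivity
  obtain ⟨hcont, hmono⟩ := h.continuousOn_and_strictMonoOn_sumAt hc hx hT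
  have him : sumAt T '' Ioo 0 x = Ioo 1 (sumAt T x) := by
    apply Subset.antisymm
    · rintro _ ⟨z, hz, rfl⟩
      have h0 := hmono ⟨le_rfl, hx⟩ (Ioo_subset_Icc_self hz) hz.1
      rw [h.sumAt_fst_zero] at h0
      exact ⟨h0, hmono (Ioo_subset_Icc_self hz) ⟨hx, le_rfl⟩ hz.2⟩
    · have := intermediate_value_Ioo hx hcont
      rwa [h.sumAt_fst_zero] at this
  have hconv : ∀ z ∈ Ioo 0 x, ConvAt T z := fun z hz => hT.mono (by
    rw [abs_of_nonneg hz.1.le, abs_of_nonneg hx]; exact hz.2.le)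
  have hd : ∀ z ∈ Ioo 0 x, HasDerivWithinAt (sumAt T) (sumAt V z ^ (m - 1)) (Ioo 0 x) z := by
    intro z hz
    have := h.hasDerivAt_fst hT (h.convAt_snd hc.le hx hT) (x := z)
      (by rw [abs_of_nonneg hz.1.le, abs_of_nonneg hx]; exact hz.2)
    rw [one_mul] at this
    exact this.hasDerivWithinAt
  rw [← him, lintegral_image_eq_lintegral_abs_deriv_mul measurableSet_Ioo hd
    (hmono.injOn.mono Ioo_subset_Icc_self)]
  have hone : ∀ z ∈ Ioo 0 x, ENNReal.ofReal |sumAt V z ^ (m - 1)| *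
      ENNReal.ofReal (1 / (sumAt T z ^ n - 1) ^ (((m : ℝ) - 1) / m)) = 1 := by
    intro z hz
    have hV := h.sumAt_snd_pos hc hz.1 (hconv z hz)
    rw [h.sumAt_pow_eq hm hn (hconv z hz) (h.convAt_snd hc.le hz.1.le (hconv z hz)), one_mul,
      add_sub_cancel_left, pow_rpow_sub_one_div hm hV.le, abs_of_pos (pow_pos hV _),
      ← ENNReal.ofReal_mul (pow_pos hV _).le, mul_one_div_cancel (pow_pos hV _).ne',
      ENNReal.ofReal_one]
  rw [setLIntegral_congr_fun measurableSet_Ioo hone]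
  simp

theorem ofReal_le_mu (hm : m ≠ 0) (hn : n ≠ 0) (h : IsFormalSolution m n 1 (n / m : ℝ) T V)
    (hx : 0 ≤ x) (hT : ConvAt T x) : ENNReal.ofReal x ≤ mu m n := by
  rw [← h.setLIntegral_eq hm hn hx hT]
  exact lintegral_mono_set Ioo_subset_Ioi_self

/-- If the solution converges on `[0, R)` with `R < mu m n`, it is bounded there: otherwise the
intervals `(1, T(x))`, `x < R`, exhaust `(1, ∞)`, and the integral defining `mu` is at most
`R`. -/
theorem exists_bound (hm : m ≠ 0) (hn : n ≠ 0) (h : IsFormalSolution m n 1 (n / m : ℝ) T V) {R : ℝ}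
    (hT : ∀ x, 0 ≤ x → x < R → ConvAt T x) (hR : ENNReal.ofReal R < mu m n) :
    ∃ B, ∀ x, 0 ≤ x → x < R → sumAt T x ≤ B := by
  have hc : (0 : ℝ) < n / m := by positivity
  by_contra! hB
  choose x hx0 hxR hxB using fun N : ℕ => hB N
  have hU : Ioi (1 : ℝ) = ⋃ N, Ioo 1 (sumAt T (x N)) := by
    ext t
    simp only [mem_Ioi, mem_iUnion, mem_Ioo, exists_and_left, iff_self_and]
    intro _
    obtain ⟨N, hN⟩ := exists_nat_gt t
    exact ⟨N, hN.trans (hxB N)⟩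
  refine hR.not_ge ?_
  rw [mu, hU, setLIntegral_iUnion_of_directed]
  · refine iSup_le fun N => ?_
    rw [h.setLIntegral_eq hm hn (hx0 N) (hT _ (hx0 N) (hxR N))]
    exact ENNReal.ofReal_le_ofReal (hxR N).le
  · intro i j
    rcases le_total (sumAt T (x i)) (sumAt T (x j)) with hij | hij
    · exact ⟨j, Ioo_subset_Ioo_right hij, subset_rfl⟩
    · exact ⟨i, subset_rfl, Ioo_subset_Ioo_right hij⟩

/-- The radius of convergence of the solution is `mu m n`. -/
theorem radius_eq_mu (hm : m ≠ 0) (hn : n ≠ 0) (h : IsFormalSolution m n 1 (n / m : ℝ) T V)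
    {a : ℕ → ℝ} (ha : ∀ k, |a k| = coeff k T) :
    (FormalMultilinearSeries.ofScalars ℝ a).radius = mu m n := by
  have hc : (0 : ℝ) < n / m := by positivity
  have hT0 := fun k => (h.coeff_nonneg hc.le k).1
  have hV0 := fun k => (h.coeff_nonneg hc.le k).2
  have hnorm (k : ℕ) : ‖FormalMultilinearSeries.ofScalars ℝ a k‖ = |coeff k T| := by
    rw [FormalMultilinearSeries.ofScalars_norm, Real.norm_eq_abs, ha, abs_of_nonneg (hT0 k)]
  have hlt {x : ℝ} (hx : 0 ≤ x)
      (hr : ENNReal.ofReal x < (FormalMultilinearSeries.ofScalars ℝ a).radius) : ConvAt T x := by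
    have := (FormalMultilinearSeries.ofScalars ℝ a).summable_norm_mul_pow hr
    simpa only [ConvAt, hnorm, norm_mul, norm_pow, Real.norm_eq_abs, Real.coe_toNNReal x hx,
      abs_of_nonneg hx] using this
  have hle {x : ℝ} (hx : 0 ≤ x) (hr : ConvAt T x) :
      ENNReal.ofReal x ≤ (FormalMultilinearSeries.ofScalars ℝ a).radius := by
    refine FormalMultilinearSeries.le_radius_of_summable _ ?_
    simpa only [ConvAt, hnorm, norm_mul, norm_pow, Real.norm_eq_abs, Real.coe_toNNReal x hx,
      abs_of_nonneg hx] using hr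
  apply le_antisymm
  · refine ENNReal.le_of_forall_nnreal_lt fun r hr => ?_
    rw [← ENNReal.ofReal_coe_nnreal] at hr ⊢
    exact h.ofReal_le_mu hm hn r.2 (hlt r.2 hr)
  · by_contra! hlt_mu
    have htop := (hlt_mu.trans_le le_top).ne
    set R := (FormalMultilinearSeries.ofScalars ℝ a).radius.toReal with hRdef
    have hR : (FormalMultilinearSeries.ofScalars ℝ a).radius = ENNReal.ofReal R :=
      (ENNReal.ofReal_toReal htop).symm
    have hR0 : 0 ≤ R := ENNReal.toReal_nonneg
    have hconv (x : ℝ) (hx : 0 ≤ x) (hxR : x < R) : ConvAt T x := by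
      refine hlt hx ?_
      rw [hR]
      exact (ENNReal.ofReal_lt_ofReal_iff (hx.trans_lt hxR)).2 hxR
    have hRpos : 0 < R := by
      obtain ⟨y, hy0, hy⟩ := h.exists_convAt_gt hc.le le_rfl (convAt_zero T)
      have := hle hy0.le hy
      rw [hR, ENNReal.ofReal_le_ofReal_iff hR0] at this
      exact hy0.trans_le this
    obtain ⟨B, hB⟩ := h.exists_bound hm hn hconv (hR ▸ hlt_mu)
    have hB1 : 1 ≤ B := (h.one_le_sumAt_fst hc.le le_rfl (convAt_zero T)).trans (hB 0 le_rfl hRpos)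
    have hBV (x : ℝ) (hx : 0 ≤ x) (hxR : x < R) : sumAt V x ≤ B ^ n := by
      have hV := h.convAt_snd hc.le hx (hconv x hx hxR)
      by_contra! hcon
      have h1 := h.sumAt_pow_eq hm hn (hconv x hx hxR) hV
      have h2 : sumAt T x ^ n ≤ B ^ n :=
        pow_le_pow_left₀ (zero_le_one.trans (h.one_le_sumAt_fst hc.le hx (hconv x hx hxR)))
          (hB x hx hxR) n
      have h3 : 1 ≤ sumAt V x := (one_le_pow₀ hB1).trans hcon.le
      have h4 : sumAt V x ≤ sumAt V x ^ m := le_self_pow₀ h3 hm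
      linarith
    -- The bounds on `[0, R)` pass to the partial sums at `R`.
    have hlim {f : ℝ⟦X⟧} {M : ℝ} (hf : ∀ x, 0 ≤ x → x < R → ∀ N, partialSum f N x ≤ M) (N : ℕ) :
        partialSum f N R ≤ M := by
      have ht : Tendsto (partialSum f N) (𝓝[<] R) (𝓝 (partialSum f N R)) :=
        (continuous_partialSum f N).continuousAt.tendsto.mono_left nhdsWithin_le_nhds
      refine le_of_tendsto ht ?_
      filter_upwards [Ioo_mem_nhdsLT hRpos] with x hx using hf x hx.1.le hx.2 N
    obtain ⟨δ, hδ, hconvδ⟩ := h.exists_convAt_add hc.le hR0 (B := B ^ n)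
      (hlim fun x hx hxR N => ((partialSum_le_sumAt hT0 hx (hconv x hx hxR) N).trans
        (hB x hx hxR)).trans (le_self_pow₀ hB1 hn))
      (hlim fun x hx hxR N => (partialSum_le_sumAt hV0 hx
        (h.convAt_snd hc.le hx (hconv x hx hxR)) N).trans (hBV x hx hxR))
    have := hle (by linarith) hconvδ
    rw [hR, ENNReal.ofReal_le_ofReal_iff hR0] at this
    linarith

end IsFormalSolution

/-! ### The integral defining the generalized sine -/

variable {p : ℝ} {n : ℕ} {x y : ℝ}

theorem Icc_zero_one_subset_sinValues (n : ℕ) : Icc 0 1 ⊆ sinValues n := by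
  intro y hy
  unfold sinValues
  split_ifs
  · exact ⟨by linarith [hy.1], hy.2⟩
  · exact hy.2

theorem one_mem_sinValues (n : ℕ) : (1 : ℝ) ∈ sinValues n :=
  Icc_zero_one_subset_sinValues n ⟨zero_le_one, le_rfl⟩

theorem le_one_of_mem_sinValues (hy : y ∈ sinValues n) : y ≤ 1 := by
  unfold sinValues at hy
  split_ifs at hy
  · exact hy.2
  · exact hy

theorem pow_lt_one_of_mem_sinValues (hn : n ≠ 0) {t : ℝ} (hx : x ∈ sinValues n) (hxt : x < t)
    (ht : t < 1) : t ^ n < 1 := by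
  unfold sinValues at hx
  split_ifs at hx with h
  · rw [← h.pow_abs]
    exact pow_lt_one₀ (abs_nonneg t) (abs_lt.2 ⟨hx.1.trans_lt hxt, ht⟩) hn
  · rcases le_or_gt 0 t with h0 | h0
    · exact pow_lt_one₀ h0 ht hn
    · exact (Nat.not_even_iff_odd.1 h |>.pow_neg h0).trans zero_lt_one

theorem intervalIntegrable_integrand_zero_one (hp : 1 < p) (hn : n ≠ 0) :
    IntervalIntegrable (fun t : ℝ => 1 / (1 - t ^ n) ^ (1 / p)) volume 0 1 := by
  have hp0 : 0 < p := zero_lt_one.trans hp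
  have h1 : IntervalIntegrable (fun t : ℝ => (1 - t) ^ (-(1 / p))) volume 0 1 := by
    have hlt : 1 / p < 1 := by rw [div_lt_one hp0]; exact hp
    have := (intervalIntegral.intervalIntegrable_rpow' (a := 1) (b := 0) (r := -(1 / p))
      (by linarith)).comp_sub_left 1
    simpa using this
  have hm : Measurable (fun t : ℝ => 1 / (1 - t ^ n) ^ (1 / p)) := by fun_prop
  refine h1.mono_fun hm.aestronglyMeasurable ?_
  filter_upwards [ae_restrict_mem measurableSet_uIoc] with t ht
  rw [uIoc_of_le zero_le_one] at ht
  rcases ht.2.eq_or_lt with rfl | ht1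
  · simp [Real.zero_rpow (inv_ne_zero hp0.ne')]
  · have h2 : t ^ n ≤ t := pow_le_of_le_one ht.1.le ht.2 hn
    have h3 : 0 < 1 - t := by linarith
    rw [Real.norm_of_nonneg (by have : 0 ≤ 1 - t ^ n := by linarith
                                positivity),
      Real.norm_of_nonneg (by positivity), Real.rpow_neg h3.le, one_div]
    gcongr

theorem intervalIntegrable_integrand_zero (hp : 1 < p) (hn : n ≠ 0) (hy : y ∈ sinValues n) :
    IntervalIntegrable (fun t : ℝ => 1 / (1 - t ^ n) ^ (1 / p)) volume 0 y := by
  have hy1 := le_one_of_mem_sinValues hy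
  have h01 := intervalIntegrable_integrand_zero_one (p := p) hp hn
  rcases le_or_gt 0 y with h0 | h0
  · refine h01.mono_set ?_
    rw [uIcc_of_le h0, uIcc_of_le zero_le_one]
    exact Icc_subset_Icc_right hy1
  · unfold sinValues at hy
    split_ifs at hy with hev
    · have := h01.comp_sub_left 0
      simp only [zero_sub, hev.neg_pow, neg_zero] at this
      refine this.mono_set ?_
      rw [uIcc_of_ge h0.le, uIcc_of_ge (by norm_num)]
      exact Icc_subset_Icc_left hy.1
    · refine ContinuousOn.intervalIntegrable ?_
      rw [uIcc_of_ge h0.le]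
      have hpos (t : ℝ) (ht : t ∈ Icc y 0) : 0 < 1 - t ^ n := by
        rcases ht.2.eq_or_lt with rfl | h
        · simp [hn]
        · linarith [(Nat.not_even_iff_odd.1 hev).pow_neg h]
      refine ContinuousOn.div continuousOn_const ?_ fun t ht =>
        (Real.rpow_pos_of_pos (hpos t ht) _).ne'
      exact ContinuousOn.rpow_const (by fun_prop) fun t ht => Or.inl (hpos t ht).ne'

theorem F_zero (p : ℝ) (n : ℕ) : F p n 0 = 0 := by simp [F]

theorem strictMonoOn_F (hp : 1 < p) (hn : n ≠ 0) : StrictMonoOn (F p n) (sinValues n) := by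
  intro x hx y hy hxy
  have h1 := intervalIntegrable_integrand_zero hp hn hx
  have h2 := intervalIntegrable_integrand_zero hp hn hy
  rw [← sub_pos, F, F, intervalIntegral.integral_interval_sub_left h2 h1]
  refine intervalIntegral.intervalIntegral_pos_of_pos_on (h1.symm.trans h2) (fun t ht => ?_) hxy
  have := pow_lt_one_of_mem_sinValues hn hx ht.1 (ht.2.trans_le (le_one_of_mem_sinValues hy))
  have h3 : 0 < 1 - t ^ n := by linarith
  positivity

theorem hasDerivAt_F (hp : 1 < p) (hn : n ≠ 0) (hy : y ∈ Ioo (0 : ℝ) 1) :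
    HasDerivAt (F p n) (1 / (1 - y ^ n) ^ (1 / p)) y := by
  have h3 : 0 < 1 - y ^ n := sub_pos.2 (pow_lt_one₀ hy.1.le hy.2 hn)
  have hm : Measurable (fun t : ℝ => 1 / (1 - t ^ n) ^ (1 / p)) := by fun_prop
  refine intervalIntegral.integral_hasDerivAt_right
    (intervalIntegrable_integrand_zero hp hn
      (Icc_zero_one_subset_sinValues n (Ioo_subset_Icc_self hy)))
    hm.stronglyMeasurable.stronglyMeasurableAtFilter ?_
  refine ContinuousAt.div continuousAt_const ?_ (Real.rpow_pos_of_pos h3 _).ne'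
  exact ContinuousAt.rpow_const (by fun_prop) (Or.inl h3.ne')

theorem continuousOn_F (hp : 1 < p) (hn : n ≠ 0) : ContinuousOn (F p n) (Icc 0 1) := by
  have := intervalIntegral.continuousOn_primitive_interval' (a := (0 : ℝ))
    (intervalIntegrable_integrand_zero_one (p := p) hp hn) left_mem_uIcc
  rwa [uIcc_of_le zero_le_one] at this

theorem genPi_div_two (p : ℝ) (n : ℕ) : genPi p n / 2 = F p n 1 := by
  rw [genPi]; ring

theorem F_one_pos (hp : 1 < p) (hn : n ≠ 0) : 0 < F p n 1 := by
  rw [← F_zero p n]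
  exact strictMonoOn_F hp hn (Icc_zero_one_subset_sinValues n ⟨le_rfl, zero_le_one⟩)
    (one_mem_sinValues n) zero_lt_one

theorem Icc_subset_sinDomain (hp : 1 < p) (hn : n ≠ 0) :
    Icc 0 (F p n 1) ⊆ sinDomain p n := by
  have := intermediate_value_Icc zero_le_one (continuousOn_F (p := p) hp hn)
  rw [F_zero] at this
  exact this.trans (image_mono (Icc_zero_one_subset_sinValues n))

theorem le_F_one_of_mem_sinDomain (hp : 1 < p) (hn : n ≠ 0) (hx : x ∈ sinDomain p n) :
    x ≤ F p n 1 := by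
  obtain ⟨y, hy, rfl⟩ := hx
  exact (strictMonoOn_F hp hn).monotoneOn hy (one_mem_sinValues n) (le_one_of_mem_sinValues hy)

theorem genSin_F (hp : 1 < p) (hn : n ≠ 0) (hy : y ∈ sinValues n) : genSin p n (F p n y) = y :=
  (strictMonoOn_F hp hn).injOn.leftInvOn_invFunOn hy

theorem F_genSin (hx : x ∈ sinDomain p n) : F p n (genSin p n x) = x :=
  Function.invFunOn_eq hx

theorem genSin_mem (hx : x ∈ sinDomain p n) : genSin p n x ∈ sinValues n :=
  Function.invFunOn_mem hx

/-! ### Existence of the analytic extension -/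

theorem one_div_eq_of_conj_eq {m : ℝ} (hp : 1 < p) (h : conj p = m) : 1 / p = (m - 1) / m := by
  have h1 : p - 1 ≠ 0 := by linarith
  have h2 : p ≠ 0 := by linarith
  rw [← h, conj]
  field_simp
  ring

theorem one_lt_conj (hp : 1 < p) : 1 < conj p := by
  rw [conj, one_lt_div (by linarith)]
  linarith

/-- The sum `S` of the formal solution inverts `y ↦ F(1) - F(y)` near `0`: by the conserved
quantity, `z ↦ F(S(z)) + z` has derivative zero. -/
theorem eventually_F_sumAt_eq (hp : 1 < p) (hn : n ≠ 0) {m : ℕ} (hm : m ≠ 0)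
    (hmp : conj p = m) {S U : ℝ⟦X⟧} (h : IsFormalSolution m n (-1) (n / m : ℝ) S U) (hy : 0 < y)
    (hS : ConvAt S y) (hU : ConvAt U y) :
    ∀ᶠ z in 𝓝[≥] 0, sumAt S z ∈ Icc (0 : ℝ) 1 ∧ F p n (sumAt S z) = F p n 1 - z := by
  have hc : (0 : ℝ) < n / m := by positivity
  have habs {z : ℝ} (hz0 : 0 ≤ z) (hzy : z < y) : |z| < |y| := by
    rwa [abs_of_nonneg hz0, abs_of_pos hy]
  have hpos : ∀ᶠ z in 𝓝[≥] (0 : ℝ), 0 < sumAt S z := by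
    refine nhdsWithin_le_nhds ?_
    refine (h.hasDerivAt_fst hS hU (habs le_rfl hy)).continuousAt.eventually_const_lt ?_
    rw [h.sumAt_fst_zero]
    exact zero_lt_one
  obtain ⟨δ, hδ, hδS⟩ : ∃ δ > 0, ∀ z ∈ Ico 0 δ, 0 < sumAt S z := by
    obtain ⟨δ, hδ, h'⟩ := (mem_nhdsGE_iff_exists_Ico_subset).1 hpos
    exact ⟨δ, hδ, h'⟩
  have hev : ∀ᶠ z in 𝓝[≥] (0 : ℝ), z ∈ Ico 0 (min δ y) :=
    Ico_mem_nhdsGE (lt_min hδ hy)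
  filter_upwards [hev] with z hz
  obtain ⟨hz0, hz1⟩ := hz
  obtain ⟨hzδ, hzy⟩ := lt_min_iff.1 hz1
  rcases hz0.eq_or_lt with rfl | hz0
  · rw [h.sumAt_fst_zero, sub_zero]
    exact ⟨⟨zero_le_one, le_rfl⟩, rfl⟩
  have hdU (w : ℝ) (hw : w ∈ Icc 0 z) := h.hasDerivAt_snd hS hU (habs hw.1 (hw.2.trans_lt hzy))
  have hdS (w : ℝ) (hw : w ∈ Icc 0 z) := h.hasDerivAt_fst hS hU (habs hw.1 (hw.2.trans_lt hzy))
  have hmono : StrictMonoOn (sumAt U) (Icc 0 z) := by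
    refine strictMonoOn_of_deriv_pos (convex_Icc 0 z)
      (fun w hw => (hdU w hw).continuousAt.continuousWithinAt) fun w hw => ?_
    rw [interior_Icc] at hw
    rw [(hdU w (Ioo_subset_Icc_self hw)).deriv]
    have := hδS w ⟨hw.1.le, hw.2.trans hzδ⟩
    positivity
  have hUpos (w : ℝ) (hw : w ∈ Ioc 0 z) : 0 < sumAt U w := by
    rw [← h.sumAt_snd_zero]
    exact hmono ⟨le_rfl, hz0.le⟩ ⟨hw.1.le, hw.2⟩ hw.1
  have hrel (w : ℝ) (hw : w ∈ Icc 0 z) : 1 - sumAt S w ^ n = sumAt U w ^ m := by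
    have hlt := (habs hw.1 (hw.2.trans_lt hzy)).le
    rw [h.sumAt_pow_eq hm hn (hS.mono hlt) (hU.mono hlt)]
    ring
  have hSpos (w : ℝ) (hw : w ∈ Icc 0 z) : 0 < sumAt S w := hδS w ⟨hw.1, hw.2.trans_lt hzδ⟩
  have hSlt (w : ℝ) (hw : w ∈ Ioc 0 z) : sumAt S w < 1 := by
    have h1 := hrel w (Ioc_subset_Icc_self hw)
    have h2 := pow_pos (hUpos w hw) m
    by_contra! hcon
    have := one_le_pow₀ hcon (n := n)
    linarith
  have hSmem : MapsTo (sumAt S) (Icc 0 z) (Icc 0 1) := by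
    intro w hw
    refine ⟨(hSpos w hw).le, ?_⟩
    rcases hw.1.eq_or_lt with rfl | h0
    · rw [h.sumAt_fst_zero]
    · exact (hSlt w ⟨h0, hw.2⟩).le
  refine ⟨hSmem ⟨hz0.le, le_rfl⟩, ?_⟩
  have hcont : ContinuousOn (fun w => F p n (sumAt S w) + w) (Icc 0 z) :=
    ((continuousOn_F hp hn).comp (fun w hw => (hdS w hw).continuousAt.continuousWithinAt)
      hSmem).add continuousOn_id
  obtain ⟨w, hw, hslope⟩ := exists_hasDerivAt_eq_slope _ (fun _ => 0) hz0 hcont fun w hw => by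
    have hw' := Ioo_subset_Ioc_self hw
    have hwI := Ioo_subset_Icc_self hw
    have hd := ((hasDerivAt_F hp hn ⟨hSpos w hwI, hSlt w hw'⟩).comp w (hdS w hwI)).add
      (hasDerivAt_id w)
    rw [hrel w hwI, one_div_eq_of_conj_eq hp hmp, pow_rpow_sub_one_div hm (hUpos w hw').le] at hd
    have h0 := (pow_pos (hUpos w hw') (m - 1)).ne'
    have hzero : 1 / sumAt U w ^ (m - 1) * (-1 * sumAt U w ^ (m - 1)) + 1 = 0 := by
      field_simp
      ring
    rw [hzero] at hd
    exact hd
  rw [h.sumAt_fst_zero, eq_div_iff (by linarith)] at hslope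
  linarith

/-- If the conjugate exponent of `p` is an integer, then the generalized sine has an analytic
extension at `π_{p,n} / 2`, whose Taylor series has radius of convergence `mu m n`. -/
theorem exists_analytic_extension (hp : 1 < p) (hn : n ≠ 0) {m : ℕ} (hm : m ≠ 0)
    (hmp : conj p = m) :
    ∃ (g : ℝ → ℝ) (q : FormalMultilinearSeries ℝ ℝ ℝ), HasFPowerSeriesAt g q (genPi p n / 2) ∧
      q.radius = mu m n ∧
      IsAnalyticExtensionAt (genSin p n) (sinDomain p n) (genPi p n / 2) g := by
  rw [genPi_div_two]
  obtain ⟨S, U, h⟩ : ∃ S U, IsFormalSolution m n (-1) (n / m : ℝ) S U :=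
    ⟨_, _, isFormalSolution_picard _ _ _ _⟩
  obtain ⟨T, V, hT⟩ : ∃ T V, IsFormalSolution m n 1 (n / m : ℝ) T V :=
    ⟨_, _, isFormalSolution_picard _ _ _ _⟩
  have hc : (0 : ℝ) < n / m := by positivity
  have habs := h.abs_coeff_eq hm hT
  obtain ⟨y, hy, hTy⟩ := hT.exists_convAt_gt hc.le le_rfl (convAt_zero T)
  have hVy := hT.convAt_snd hc.le hy.le hTy
  have hSy : ConvAt S y := convAt_of_abs_coeff_le hTy fun k => (habs k).1.le
  have hUy : ConvAt U y := convAt_of_abs_coeff_le hVy fun k => (habs k).2.le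
  have hseries : HasFPowerSeriesAt (fun x => sumAt S (F p n 1 - x))
      (FormalMultilinearSeries.ofScalars ℝ fun k => (-1) ^ k * coeff k S) (F p n 1) := by
    rw [hasFPowerSeriesAt_iff']
    filter_upwards [Ioo_mem_nhds (sub_lt_self (F p n 1) hy) (lt_add_of_pos_right (F p n 1) hy)]
      with x hx
    have hx' : |F p n 1 - x| ≤ |y| := by
      rw [abs_of_pos hy, abs_le]
      constructor <;> linarith [hx.1, hx.2]
    have hterm : (fun k => (x - F p n 1) ^ k • (FormalMultilinearSeries.ofScalars ℝ
        fun k => (-1) ^ k * coeff k S).coeff k) = fun k => coeff k S * (F p n 1 - x) ^ k := by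
      ext k
      rw [FormalMultilinearSeries.coeff_ofScalars, smul_eq_mul, ← neg_sub x, neg_pow (x - F p n 1)]
      ring
    rw [hterm]
    exact (hSy.mono hx').of_norm.hasSum
  refine ⟨_, _, hseries, hT.radius_eq_mu hm hn fun k => ?_, hseries.analyticAt, ?_⟩
  · rw [abs_mul, abs_pow, abs_neg, abs_one, one_pow, one_mul, (habs k).1,
      abs_of_nonneg (hT.coeff_nonneg hc.le k).1]
  · have htend : Tendsto (fun x => F p n 1 - x) (𝓝[sinDomain p n] F p n 1) (𝓝[≥] 0) := by
      refine tendsto_nhdsWithin_iff.2 ⟨?_, ?_⟩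
      · refine Tendsto.mono_left ?_ nhdsWithin_le_nhds
        have : Continuous fun x => F p n 1 - x := by fun_prop
        simpa using this.tendsto (F p n 1)
      · filter_upwards [self_mem_nhdsWithin] with x hx
        exact sub_nonneg.2 (le_F_one_of_mem_sinDomain hp hn hx)
    filter_upwards [htend.eventually (eventually_F_sumAt_eq hp hn hm hmp h hy hSy hUy)] with x hx
    rw [← genSin_F hp hn (Icc_zero_one_subset_sinValues n hx.1), hx.2, sub_sub_cancel]

/-! ### The order of the critical point and uniqueness of the extension -/

variable {g : ℝ → ℝ}

theorem nhdsLT_le_nhdsWithin_sinDomain (hp : 1 < p) (hn : n ≠ 0) :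
    𝓝[<] (F p n 1) ≤ 𝓝[sinDomain p n] (F p n 1) := by
  refine le_inf nhdsWithin_le_nhds (le_principal_iff.2 ?_)
  filter_upwards [Ioo_mem_nhdsLT (F_one_pos hp hn)] with x hx
  exact Icc_subset_sinDomain hp hn (Ioo_subset_Icc_self hx)

/-- A power of the distance to `a` tends to a nonzero limit only if the exponent is zero. -/
theorem eq_zero_of_tendsto_rpow {a e L : ℝ} (hL : L ≠ 0)
    (h : Tendsto (fun x => (a - x) ^ e) (𝓝[<] a) (𝓝 L)) : e = 0 := by
  have key {e : ℝ} (he : 0 < e) : Tendsto (fun x => (a - x) ^ e) (𝓝[<] a) (𝓝 0) := by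
    have hc : ContinuousAt (fun x => (a - x) ^ e) a :=
      ContinuousAt.rpow_const (by fun_prop) (Or.inr he.le)
    have := hc.tendsto.mono_left (nhdsWithin_le_nhds (s := Iio a))
    simpa [Real.zero_rpow he.ne'] using this
  rcases lt_trichotomy e 0 with he | he | he
  · have h1 := key (neg_pos.2 he)
    have h2 : Tendsto (fun x => (a - x) ^ (-e)) (𝓝[<] a) (𝓝 L⁻¹) := by
      refine (h.inv₀ hL).congr' ?_
      filter_upwards [self_mem_nhdsWithin] with x hx
      rw [Real.rpow_neg (sub_nonneg.2 (le_of_lt hx))]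
    exact absurd (tendsto_nhds_unique h2 h1) (inv_ne_zero hL)
  · exact he
  · exact absurd (tendsto_nhds_unique h (key he)) hL

theorem IsAnalyticExtensionAt.apply_eq_one (hp : 1 < p) (hn : n ≠ 0)
    (hg : IsAnalyticExtensionAt (genSin p n) (sinDomain p n) (F p n 1) g) : g (F p n 1) = 1 := by
  rw [hg.2.eq_of_nhdsWithin (Icc_subset_sinDomain hp hn ⟨(F_one_pos hp hn).le, le_rfl⟩)]
  exact genSin_F hp hn (one_mem_sinValues n)

/-- An analytic extension satisfies the differential equation of the generalized sine on the
left of `π_{p,n} / 2`. -/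
theorem IsAnalyticExtensionAt.eventually_deriv_eq (hp : 1 < p) (hn : n ≠ 0)
    (hg : IsAnalyticExtensionAt (genSin p n) (sinDomain p n) (F p n 1) g) :
    ∀ᶠ x in 𝓝[<] (F p n 1),
      g x ∈ Ioo 0 1 ∧ deriv g x = (1 - g x ^ n) ^ (1 / p) := by
  have hinv : ∀ᶠ x in 𝓝[<] (F p n 1), g x ∈ Ioo 0 1 ∧ F p n (g x) = x := by
    have hpos : ∀ᶠ x in 𝓝[<] (F p n 1), 0 < g x := by
      refine nhdsWithin_le_nhds (hg.1.continuousAt.eventually_const_lt ?_)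
      rw [hg.apply_eq_one hp hn]
      exact zero_lt_one
    filter_upwards [hpos, nhdsLT_le_nhdsWithin_sinDomain hp hn hg.2,
      nhdsLT_le_nhdsWithin_sinDomain hp hn self_mem_nhdsWithin, self_mem_nhdsWithin]
      with x hx0 hgx hx hx1
    have hF : F p n (g x) = x := by rw [hgx, F_genSin hx]
    refine ⟨⟨hx0, lt_of_le_of_ne ?_ ?_⟩, hF⟩
    · rw [hgx]
      exact le_one_of_mem_sinValues (genSin_mem hx)
    · intro h1
      rw [h1] at hF
      exact (ne_of_lt hx1) hF.symm
  have hdiff : ∀ᶠ x in 𝓝[<] (F p n 1), DifferentiableAt ℝ g x :=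
    nhdsWithin_le_nhds (hg.1.eventually_analyticAt.mono fun x hx => hx.differentiableAt)
  filter_upwards [hinv, eventually_eventually_nhdsWithin.2 hinv, hdiff, self_mem_nhdsWithin]
    with x hx hx' hd hx1
  rw [isOpen_Iio.nhdsWithin_eq hx1] at hx'
  refine ⟨hx.1, ?_⟩
  have h1 := (hasDerivAt_F hp hn hx.1).comp x hd.hasDerivAt
  have h2 : HasDerivAt (F p n ∘ g) 1 x :=
    (hasDerivAt_id x).congr_of_eventuallyEq (hx'.mono fun y hy => hy.2)
  have h3 := h1.unique h2
  have h4 : 0 < (1 - g x ^ n) ^ (1 / p) :=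
    Real.rpow_pos_of_pos (sub_pos.2 (pow_lt_one₀ hx.1.1.le hx.1.2 hn)) _
  field_simp at h3
  exact h3

/-- Comparison of the orders of vanishing in `g' = (1 - g ^ n) ^ (1 / p)`: if `g'` vanishes
to order `k`, and hence `1 - g` to order `k + 1`, then `k = (k + 1) / p`, so that `k + 1` is the
conjugate exponent of `p`. -/
theorem IsAnalyticExtensionAt.exists_order (hp : 1 < p) (hn : n ≠ 0)
    (hg : IsAnalyticExtensionAt (genSin p n) (sinDomain p n) (F p n 1) g) :
    ∃ k : ℕ, analyticOrderAt (deriv g) (F p n 1) = k ∧ conj p = (k + 1 : ℕ) := by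
  set a := F p n 1 with ha
  have hga : g a = 1 := hg.apply_eq_one hp hn
  have hode := hg.eventually_deriv_eq hp hn
  have hord := hg.1.analyticOrderAt_deriv_add_one
  have han : AnalyticAt ℝ (g · - g a) a := hg.1.sub analyticAt_const
  have htop : analyticOrderAt (deriv g) a ≠ ⊤ := by
    intro h
    rw [h, top_add, eq_comm, analyticOrderAt_eq_top] at hord
    have : ∀ᶠ x in 𝓝[<] a, False := by
      filter_upwards [hode, nhdsWithin_le_nhds hord] with x hx hx'
      rw [hga] at hx'
      linarith [hx.1.2]
    exact this.exists.elim fun _ h => h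
  obtain ⟨k, hk⟩ := ENat.ne_top_iff_exists.1 htop
  refine ⟨k, hk.symm, ?_⟩
  obtain ⟨u, hu, hu0, hgu⟩ := hg.1.deriv.analyticOrderAt_eq_natCast.1 hk.symm
  obtain ⟨v, hv, hv0, hgv⟩ := (han.analyticOrderAt_eq_natCast (n := k + 1)).1 (by
    rw [← hord, ← hk]; rfl)
  have hp0 : 0 < p := zero_lt_one.trans hp
  -- `G` is the cofactor in `g ^ n - 1 = G (g - 1)`; it does not vanish at `a`.
  set G : ℝ → ℝ := fun x => ∑ i ∈ Finset.range n, g x ^ i with hG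
  have hGa : G a = n := by simp [hG, hga]
  have hGc : ContinuousAt G a := by
    have := hg.1.continuousAt
    fun_prop
  have hn0 : (0 : ℝ) < n := by exact_mod_cast Nat.pos_of_ne_zero hn
  have hQ : Tendsto (fun x => (|v x| * |G x|) ^ (1 / p) / |u x|) (𝓝[<] a)
      (𝓝 ((|v a| * |G a|) ^ (1 / p) / |u a|)) := by
    refine ContinuousAt.continuousWithinAt ?_
    refine ContinuousAt.div (ContinuousAt.rpow_const (hv.continuousAt.abs.mul hGc.abs) ?_)
      hu.continuousAt.abs (abs_pos.2 hu0).ne'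
    exact Or.inr (by positivity)
  have hL : (|v a| * |G a|) ^ (1 / p) / |u a| ≠ 0 := by
    have h1 := abs_pos.2 hv0
    have h2 := abs_pos.2 hu0
    rw [hGa, abs_of_pos hn0]
    positivity
  have hu_ne : ∀ᶠ x in 𝓝[<] a, u x ≠ 0 :=
    nhdsWithin_le_nhds (hu.continuousAt.eventually_ne hu0)
  -- With `|g'| = (a - x) ^ k |u|` and `|1 - g| = (a - x) ^ (k + 1) |v|`, the differential
  -- equation expresses a power of `a - x` by a function with nonzero limit.
  have he : (k : ℝ) - (k + 1) / p = 0 := by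
    refine eq_zero_of_tendsto_rpow hL (hQ.congr' ?_)
    filter_upwards [hode, nhdsWithin_le_nhds hgu, nhdsWithin_le_nhds hgv, self_mem_nhdsWithin,
      hu_ne] with x hx hxu hxv hxa hux
    have hz : 0 < a - x := sub_pos.2 hxa
    have habs : |x - a| = a - x := by rw [abs_sub_comm, abs_of_pos hz]
    rw [hga, smul_eq_mul] at hxv
    rw [smul_eq_mul] at hxu
    have h1 : 0 < 1 - g x ^ n := sub_pos.2 (pow_lt_one₀ hx.1.1.le hx.1.2 hn)
    have h2 : 1 - g x ^ n = (a - x) ^ (k + 1) * (|v x| * |G x|) := by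
      rw [← abs_of_pos h1, abs_sub_comm, ← geom_sum_mul, hxv, abs_mul, abs_mul, abs_pow, habs]
      ring
    have h3 : (a - x) ^ k * |u x| = ((a - x) ^ (k + 1) * (|v x| * |G x|)) ^ (1 / p) := by
      rw [← h2, ← hx.2, ← habs, ← abs_pow, ← abs_mul, ← hxu, hx.2]
      exact abs_of_pos (Real.rpow_pos_of_pos h1 _)
    rw [Real.mul_rpow (by positivity) (by positivity), ← Real.rpow_natCast, ← Real.rpow_natCast,
      ← Real.rpow_mul hz.le] at h3
    have h4 := abs_pos.2 hux
    rw [Real.rpow_sub hz, div_eq_div_iff h4.ne' (Real.rpow_pos_of_pos hz _).ne', h3]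
    push_cast
    rw [mul_one_div]
    ring
  rw [conj]
  have h1 : p - 1 ≠ 0 := by linarith
  field_simp at he ⊢
  push_cast
  linarith

/-- Two analytic extensions have the same germ. -/
theorem IsAnalyticExtensionAt.eventuallyEq (hp : 1 < p) (hn : n ≠ 0) {g' : ℝ → ℝ}
    (hg : IsAnalyticExtensionAt (genSin p n) (sinDomain p n) (F p n 1) g)
    (hg' : IsAnalyticExtensionAt (genSin p n) (sinDomain p n) (F p n 1) g') :
    g =ᶠ[𝓝 (F p n 1)] g' := by
  refine (hg.1.frequently_eq_iff_eventually_eq hg'.1).1 ?_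
  have h : ∀ᶠ x in 𝓝[<] (F p n 1), g x = g' x :=
    nhdsLT_le_nhdsWithin_sinDomain hp hn (hg.2.trans hg'.2.symm)
  exact h.frequently.filter_mono (nhdsWithin_mono _ fun x hx => ne_of_lt hx)

end GenSine

end

theorem theorem1 (p : ℝ) (hp : 1 < p) (n : ℕ) (hn : 1 < n) :
    ((∃ g : ℝ → ℝ, GenSine.IsAnalyticExtensionAt (GenSine.genSin p n) (GenSine.sinDomain p n)
        (GenSine.genPi p n / 2) g) ↔
      ∃ m : ℤ, GenSine.conj p = (m : ℝ)) ∧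
    (∀ m : ℕ, GenSine.conj p = (m : ℝ) →
      ∀ g : ℝ → ℝ, GenSine.IsAnalyticExtensionAt (GenSine.genSin p n) (GenSine.sinDomain p n)
        (GenSine.genPi p n / 2) g →
      GenSine.IsCriticalPointOfOrder g (GenSine.genPi p n / 2) (m - 1) ∧
      (GenSine.taylorSeriesAt g (GenSine.genPi p n / 2)).radius =
        GenSine.mu (GenSine.conj p) n) := by
  have hn0 : n ≠ 0 := by omega
  have hconj := GenSine.one_lt_conj hp
  refine ⟨⟨?_, ?_⟩, ?_⟩
  · rintro ⟨g, hg⟩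
    rw [GenSine.genPi_div_two] at hg
    obtain ⟨k, -, hk⟩ := hg.exists_order hp hn0
    exact ⟨(k + 1 : ℕ), by rw [hk, Int.cast_natCast]⟩
  · rintro ⟨m, hm⟩
    have hm1 : 1 < m := by rw [hm] at hconj; exact_mod_cast hconj
    lift m to ℕ using by omega
    obtain ⟨g, -, -, -, hg⟩ := GenSine.exists_analytic_extension hp hn0 (m := m) (by omega)
      (by rw [hm, Int.cast_natCast])
    exact ⟨g, hg⟩
  · intro m hm g hg
    have hm1 : 1 < m := by rw [hm] at hconj; exact_mod_cast hconj
    obtain ⟨g', q, hq, hrad, hg'⟩ := GenSine.exists_analytic_extension hp hn0 (by omega) hm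
    rw [GenSine.genPi_div_two] at *
    constructor
    · obtain ⟨k, hk, hkp⟩ := hg.exists_order hp hn0
      rw [hm] at hkp
      have : m = k + 1 := by exact_mod_cast hkp
      subst this
      exact ⟨by omega, by simpa using hk⟩
    · have hgq := hq.congr (hg'.eventuallyEq hp hn0 hg)
      rw [hm, ← hrad, GenSine.taylorSeriesAt,
        hg.1.hasFPowerSeriesAt.eq_formalMultilinearSeries hgq]
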